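/- Let $m=\langle\cdot,\cdot\rangle$ be a bi-invariant Riemannian metric on $\mathrm{SO}(3)$ (left and right translations are isometries), with Levi-Civita connection $\nabla$. Write $g\in\mathrm{SO}(3)$ in ZYZ Euler angles as $g=r_z(\alpha)r_y(\beta)r_z(\gamma)$, where $r_z(\alpha)$, $r_y(\beta)$ are the rotations about the $z$- and $y$-axes and $(\alpha,\beta,\gamma)\in[0,2\pi)\times[0,\pi]\times[0,2\pi)$, and for integers $\ell\ge 0$ and $|n|,|n'|\le \ell$ let $$D^\ell_{n,n'}(g)=e^{-in\alpha}\,d^\ell_{n,n'}(\beta)\,e^{-in'\gamma}$$ be the Wigner $D$-functions, where $$d^\ell_{n,n'}(\beta)=\sqrt{(\ell+n)!(\ell-n)!(\ell+n')!(\ell-n')!}\;\sum_{s}\frac{(-1)^{n-n'+s}\cos(\beta/2)^{2\ell+n'-n-2s}\sin(\beta/2)^{n-n'+2s}}{(\ell+n'-s)!\,s!\,(n-n'+s)!\,(\ell-n-s)!},$$ the sum being over all integers $s$ for which the arguments of the factorials are nonnegative. For an integer $L\ge 0$ let $$\Pi_L=\operatorname{span}_{\mathbb C}\{D^\ell_{n,n'}:\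 0\le \ell\le L,\ |n|\le \ell,\ |n'|\le \ell\}.$$ Then there exist constants $B_1,B_2>0$, depending only on the metric $m$ (a bi-invariant metric on $\mathrm{SO}(3)$ is determined by its normalization), such that for every integer $L\ge 0$, every $F\in\Pi_L$ is a smooth bounded function on $\mathrm{SO}(3)$ and satisfies $$\|\nabla F\|_{\infty}\le B_1(1+L)\,\|F\|_{\infty},\qquad \|\nabla^2F\|_{\infty,\mathrm{op}}\le B_2(1+L)^2\,\|F\|_{\infty}.$$ Here $\|F\|_\infty=\sup_{g}|F(g)|$, and $\|\nabla F\|_\infty=\sup_g|\nabla F(g)|$, where $\nabla F$ is the Riemannian gradient, $\langle\nabla F,X\rangle=XF$, extended complex-linearly to complex-valued $F$, and $|\cdot|$ is the Hermitian norm on $T_g\mathrm{SO}(3)\otimes\mathbb C$ extending $m$. Further, $\|\nabla^2F\|_{\infty,\mathrm{op}}=\sup_g\sup_{|v|,|w|\le 1}|\nabla^2F(g)(v,w)|$, where $v,w\in T_g\mathrm{SO}(3)\otimes\mathbb C$ and $\nabla^2F$ is the (complex-bilinear extension of the) Riemannian Hessian $\nabla^2F(X,Y)=X(YF)-(\nabla_XY)F$.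 -/

import Mathlib

open scoped ContDiff ENNReal Nat Matrix

noncomputable section

namespace SO3Bernstein

/-! ### The group, its Lie algebra and its tangent spaces -/

/-- The rotation group `SO(3)`. -/
abbrev SO3 : Type := Matrix.specialOrthogonalGroup (Fin 3) ℝ

/-- Real `3 × 3` matrices. -/
abbrev Mat3 : Type := Matrix (Fin 3) (Fin 3) ℝ

/-- The Lie algebra `so(3)` of skew-symmetric matrices, with the commutator bracket. -/
abbrev so3 : Type := LieAlgebra.Orthogonal.so (Fin 3) ℝ

theorem transpose_mul_self (g : SO3) : g.1ᵀ * g.1 = 1 :=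
  (Matrix.mem_orthogonalGroup_iff' (Fin 3) ℝ).1 g.2.1

theorem mem_SO3_of {A : Mat3} (h : Aᵀ * A = 1) (hd : A.det = 1) :
    A ∈ Matrix.specialOrthogonalGroup (Fin 3) ℝ :=
  Matrix.mem_specialOrthogonalGroup_iff.2 ⟨(Matrix.mem_orthogonalGroup_iff' (Fin 3) ℝ).2 h, hd⟩

/-- The tangent space `T_g SO(3)`, as a subspace of the space of `3 × 3` matrices: the kernel of
the linearization at `g` of the equation `gᵀ g = 1`. -/
def tangent (g : SO3) : Submodule ℝ Mat3 where
  carrier := {V | Vᵀ * g.1 + g.1ᵀ * V = 0}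
  zero_mem' := by simp
  add_mem' := by
    intro V W hV hW
    simp only [Set.mem_ofPred_eq, Matrix.transpose_add, add_mul, mul_add] at *
    rw [add_add_add_comm, hV, hW, add_zero]
  smul_mem' := by
    intro c V hV
    simp only [Set.mem_ofPred_eq, Matrix.transpose_smul, Matrix.smul_mul, Matrix.mul_smul] at *
    rw [← smul_add, hV, smul_zero]

/-- The differential `V ↦ h V` of the left translation `g ↦ h g`. -/
def leftTranslate (h g : SO3) (V : tangent g) : tangent (h * g) :=
  ⟨h.1 * V.1, by
    have hV : V.1ᵀ * g.1 + g.1ᵀ * V.1 = 0 := V.2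
    change (h.1 * V.1)ᵀ * (h.1 * g.1) + (h.1 * g.1)ᵀ * (h.1 * V.1) = 0
    simp only [Matrix.transpose_mul, Matrix.mul_assoc]
    simp only [← Matrix.mul_assoc _ h.1, transpose_mul_self, Matrix.one_mul]
    exact hV⟩

/-- The differential `V ↦ V h` of the right translation `g ↦ g h`. -/
def rightTranslate (h g : SO3) (V : tangent g) : tangent (g * h) :=
  ⟨V.1 * h.1, by
    have hV : V.1ᵀ * g.1 + g.1ᵀ * V.1 = 0 := V.2
    change (V.1 * h.1)ᵀ * (g.1 * h.1) + (g.1 * h.1)ᵀ * (V.1 * h.1) = 0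
    have e : (V.1 * h.1)ᵀ * (g.1 * h.1) + (g.1 * h.1)ᵀ * (V.1 * h.1)
        = h.1ᵀ * (V.1ᵀ * g.1 + g.1ᵀ * V.1) * h.1 := by
      simp only [Matrix.transpose_mul, mul_add, add_mul, Matrix.mul_assoc]
    rw [e, hV]
    simp⟩

theorem transpose_so3 (A : so3) : A.1ᵀ = -A.1 :=
  (LieAlgebra.Orthogonal.mem_so (Fin 3) ℝ _).1 A.2

/-- The left-invariant vector field `X_A : g ↦ g A` generated by `A ∈ so(3)`. -/
def leftField (A : so3) (g : SO3) : tangent g :=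
  ⟨g.1 * A.1, by
    change (g.1 * A.1)ᵀ * g.1 + g.1ᵀ * (g.1 * A.1) = 0
    rw [Matrix.transpose_mul, Matrix.mul_assoc, transpose_mul_self, ← Matrix.mul_assoc,
      transpose_mul_self, transpose_so3]
    simp⟩

theorem exp_orthogonal (A : so3) : (NormedSpace.exp A.1)ᵀ * NormedSpace.exp A.1 = 1 := by
  rw [← Matrix.exp_transpose, transpose_so3, Matrix.exp_neg]
  exact Matrix.nonsing_inv_mul _ ((Matrix.isUnit_iff_isUnit_det _).1 (Matrix.isUnit_exp _))

theorem exp_mem (A : so3) :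
    NormedSpace.exp A.1 ∈ Matrix.specialOrthogonalGroup (Fin 3) ℝ := by
  refine mem_SO3_of (exp_orthogonal A) ?_
  have h2 : NormedSpace.exp A.1
      = NormedSpace.exp ((2⁻¹ : ℝ) • A).1 * NormedSpace.exp ((2⁻¹ : ℝ) • A).1 := by
    rw [← Matrix.exp_add_of_commute _ _ (Commute.refl _)]
    congr 1
    change A.1 = (2⁻¹ : ℝ) • A.1 + (2⁻¹ : ℝ) • A.1
    rw [← add_smul]
    norm_num
  have h1 := congrArg Matrix.det (exp_orthogonal ((2⁻¹ : ℝ) • A))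
  rw [Matrix.det_mul, Matrix.det_transpose, Matrix.det_one] at h1
  rw [h2, Matrix.det_mul, h1]

/-- The exponential map `so(3) → SO(3)`. -/
def expSO (A : so3) : SO3 := ⟨NormedSpace.exp A.1, exp_mem A⟩

/-! ### Calculus on `SO(3)` -/

/-- Smooth functions on the closed submanifold `SO(3)` of `ℝ^{3 × 3}`: the restrictions of smooth
functions on the ambient matrix space. -/
def IsSmooth {E : Type*} [NormedAddCommGroup E] [NormedSpace ℝ E] (F : SO3 → E) : Prop :=
  ∃ G : (Fin 3 → Fin 3 → ℝ) → E, ContDiff ℝ ∞ G ∧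
    ∀ g : SO3, F g = G (fun i j => g.1 i j)

/-- The derivative `X_A F` of a function along the left-invariant vector field `X_A`, whose
integral curve through `g` is `t ↦ g exp(tA)`. -/
def lieDeriv {E : Type*} [NormedAddCommGroup E] [NormedSpace ℝ E] (A : so3) (F : SO3 → E)
    (g : SO3) : E :=
  deriv (fun t : ℝ => F (g * expSO (t • A))) 0

/-- The generators of the rotations about the three coordinate axes, a basis of `so(3)`. -/
def gen (i : Fin 3) : so3 :=
  ⟨![!![0, 0, 0; 0, 0, -1; 0, 1, 0], !![0, 0, 1; 0, 0, 0; -1, 0, 0],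
      !![0, -1, 0; 1, 0, 0; 0, 0, 0]] i, by
    rw [LieAlgebra.Orthogonal.mem_so]
    fin_cases i <;> ext a b <;> fin_cases a <;> fin_cases b <;> simp⟩

/-! ### Riemannian metrics, gradient, Levi-Civita connection and Hessian

Tensors are expressed in the global frame of left-invariant vector fields `X_i = X_{gen i}`,
which need not be orthonormal; a (complexified) tangent vector
`∑ i, v i • X_i(g)` is given by its components `v : Fin 3 → ℂ`. -/

/-- A Riemannian metric on `SO(3)`. -/
structure RiemannianMetric where
  /-- The inner product on `T_g SO(3)`. -/
  inner (g : SO3) : LinearMap.BilinForm ℝ (tangent g)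
  symm (g : SO3) (V W : tangent g) : inner g V W = inner g W V
  pos (g : SO3) (V : tangent g) : V ≠ 0 → 0 < inner g V V
  smooth (A B : so3) : IsSmooth fun g => inner g (leftField A g) (leftField B g)

namespace RiemannianMetric

/-- Left and right translations are isometries. -/
def IsBiInvariant (m : RiemannianMetric) : Prop :=
  (∀ (h g : SO3) (V W : tangent g),
    m.inner (h * g) (leftTranslate h g V) (leftTranslate h g W) = m.inner g V W) ∧
  (∀ (h g : SO3) (V W : tangent g),
    m.inner (g * h) (rightTranslate h g V) (rightTranslate h g W) = m.inner g V W)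

/-- The function `⟨X_A, X_B⟩` on `SO(3)`. -/
def pair (m : RiemannianMetric) (A B : so3) (g : SO3) : ℝ :=
  m.inner g (leftField A g) (leftField B g)

/-- The matrix `⟨X_i, X_j⟩` of the metric at `g` in the left-invariant frame. -/
def gram (m : RiemannianMetric) (g : SO3) : Mat3 :=
  Matrix.of fun i j => m.pair (gen i) (gen j) g

/-- The Hermitian norm on the complexified tangent space at `g` that extends the metric. -/
def vecNorm (m : RiemannianMetric) (g : SO3) (v : Fin 3 → ℂ) : ℝ :=
  Real.sqrt (∑ i, ∑ j, (m.gram g i j : ℂ) * v i * (starRingEnd ℂ) (v j)).re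

/-- The components of the gradient `∇F`, the vector field with `⟨∇F, X⟩ = X F`. -/
def gradient (m : RiemannianMetric) (F : SO3 → ℂ) (g : SO3) (i : Fin 3) : ℂ :=
  ∑ j, ((m.gram g)⁻¹ i j : ℂ) * lieDeriv (gen j) F g

/-- Koszul's formula for `⟨∇_{X_A} X_B, X_C⟩`, where `∇` is the Levi-Civita connection; the bracket
of the vector fields `X_A` and `X_B` is `X_{[A, B]}`. -/
def koszul (m : RiemannianMetric) (A B C : so3) (g : SO3) : ℝ :=
  (lieDeriv A (m.pair B C) g + lieDeriv B (m.pair A C) g - lieDeriv C (m.pair A B) g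
    + m.pair ⁅A, B⁆ C g - m.pair ⁅A, C⁆ B g - m.pair ⁅B, C⁆ A g) / 2

/-- The connection coefficients: `∇_{X_i} X_j = ∑ k, christoffel i j k • X_k`. -/
def christoffel (m : RiemannianMetric) (g : SO3) (i j k : Fin 3) : ℝ :=
  ∑ l, (m.gram g)⁻¹ k l * m.koszul (gen i) (gen j) (gen l) g

/-- The components `∇²F(X_i, X_j) = X_i (X_j F) - (∇_{X_i} X_j) F` of the Riemannian Hessian. -/
def hessian (m : RiemannianMetric) (F : SO3 → ℂ) (g : SO3) (i j : Fin 3) : ℂ :=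
  lieDeriv (gen i) (lieDeriv (gen j) F) g
    - ∑ k, (m.christoffel g i j k : ℂ) * lieDeriv (gen k) F g

/-- The pointwise operator norm of the Hessian: the supremum of `|∇²F(v, w)|` over (complexified)
tangent vectors `v`, `w` of norm at most one. -/
def hessianOpNorm (m : RiemannianMetric) (F : SO3 → ℂ) (g : SO3) : ℝ≥0∞ :=
  ⨆ (v : Fin 3 → ℂ) (w : Fin 3 → ℂ) (_ : m.vecNorm g v ≤ 1) (_ : m.vecNorm g w ≤ 1),
    ‖∑ i, ∑ j, v i * w j * m.hessian F g i j‖ₑ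

/-- `‖∇F‖_∞`. -/
def gradientSupNorm (m : RiemannianMetric) (F : SO3 → ℂ) : ℝ≥0∞ :=
  ⨆ g : SO3, ENNReal.ofReal (m.vecNorm g (m.gradient F g))

/-- `‖∇²F‖_{∞, op}`. -/
def hessianSupNorm (m : RiemannianMetric) (F : SO3 → ℂ) : ℝ≥0∞ :=
  ⨆ g : SO3, m.hessianOpNorm F g

end RiemannianMetric

/-- `‖F‖_∞`. -/
def supNorm (F : SO3 → ℂ) : ℝ≥0∞ := ⨆ g : SO3, ‖F g‖ₑ

/-! ### Euler angles and Wigner functions -/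

/-- Rotation about the `z`-axis. -/
def rotZ (α : ℝ) : SO3 :=
  ⟨!![Real.cos α, -Real.sin α, 0; Real.sin α, Real.cos α, 0; 0, 0, 1], by
    have h := Real.sin_sq_add_cos_sq α
    refine mem_SO3_of ?_ ?_
    · ext a b
      fin_cases a <;> fin_cases b <;> simp [Matrix.mul_apply, Fin.sum_univ_three] <;> nlinarith
    · simp [Matrix.det_fin_three]
      nlinarith⟩

/-- Rotation about the `y`-axis. -/
def rotY (β : ℝ) : SO3 :=
  ⟨!![Real.cos β, 0, Real.sin β; 0, 1, 0; -Real.sin β, 0, Real.cos β], by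
    have h := Real.sin_sq_add_cos_sq β
    refine mem_SO3_of ?_ ?_
    · ext a b
      fin_cases a <;> fin_cases b <;> simp [Matrix.mul_apply, Fin.sum_univ_three] <;> nlinarith
    · simp [Matrix.det_fin_three]
      nlinarith⟩

/-- `(α, β, γ)` are ZYZ Euler angles of `g`. -/
def IsEuler (g : SO3) (e : ℝ × ℝ × ℝ) : Prop :=
  e.1 ∈ Set.Ico 0 (2 * Real.pi) ∧ e.2.1 ∈ Set.Icc 0 Real.pi ∧ e.2.2 ∈ Set.Ico 0 (2 * Real.pi) ∧
    g = rotZ e.1 * rotY e.2.1 * rotZ e.2.2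

theorem exists_angle {a b : ℝ} (h : a ^ 2 + b ^ 2 = 1) :
    ∃ t ∈ Set.Ico 0 (2 * Real.pi), Real.cos t = a ∧ Real.sin t = b := by
  have hz : ‖(⟨a, b⟩ : ℂ)‖ = 1 := by
    rw [Complex.norm_def, Complex.normSq_mk, ← pow_two, ← pow_two, h, Real.sqrt_one]
  have h0 : (⟨a, b⟩ : ℂ) ≠ 0 := by
    intro h0
    rw [h0, norm_zero] at hz
    exact zero_ne_one hz
  refine ⟨toIcoMod Real.two_pi_pos 0 (Complex.arg ⟨a, b⟩), ?_, ?_, ?_⟩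
  · simpa using toIcoMod_mem_Ico Real.two_pi_pos 0 (Complex.arg ⟨a, b⟩)
  · rw [toIcoMod, zsmul_eq_mul, Real.cos_sub_int_mul_two_pi, Complex.cos_arg h0, hz]
    simp
  · rw [toIcoMod, zsmul_eq_mul, Real.sin_sub_int_mul_two_pi, Complex.sin_arg, hz]
    simp

theorem exists_rotZ {h : SO3} (h02 : h.1 0 2 = 0) (h12 : h.1 1 2 = 0) (h22 : h.1 2 2 = 1) :
    ∃ t ∈ Set.Ico 0 (2 * Real.pi), h = rotZ t := by
  have e := transpose_mul_self h
  have hd : h.1.det = 1 := h.2.2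
  have e00 := congrFun (congrFun e 0) 0
  have e01 := congrFun (congrFun e 0) 1
  have e02 := congrFun (congrFun e 0) 2
  have e11 := congrFun (congrFun e 1) 1
  have e12 := congrFun (congrFun e 1) 2
  simp only [Matrix.mul_apply, Fin.sum_univ_three, Matrix.transpose_apply, h02, h12, h22]
    at e00 e01 e02 e11 e12
  simp at e00 e01 e02 e11 e12
  rw [Matrix.det_fin_three, h02, h12, h22, e02, e12] at hd
  rw [e02] at e00 e01
  rw [e12] at e11
  have ha : h.1 1 1 = h.1 0 0 := by
    linear_combination h.1 0 0 * hd - h.1 1 1 * e00 + h.1 1 0 * e01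
  have hb : h.1 0 1 = -h.1 1 0 := by
    linear_combination -h.1 1 0 * hd - h.1 0 1 * e00 + h.1 0 0 * e01
  obtain ⟨t, ht, hc, hs⟩ := exists_angle (a := h.1 0 0) (b := h.1 1 0) (by linarith)
  refine ⟨t, ht, Subtype.ext ?_⟩
  change h.1 = !![Real.cos t, -Real.sin t, 0; Real.sin t, Real.cos t, 0; 0, 0, 1]
  ext a b
  fin_cases a <;> fin_cases b <;> simp [*]

theorem exists_isEuler (g : SO3) : ∃ e, IsEuler g e := by
  have hT : g.1ᵀ * g.1 = 1 := transpose_mul_self g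
  have e22 := congrFun (congrFun hT 2) 2
  simp only [Matrix.mul_apply, Fin.sum_univ_three, Matrix.transpose_apply] at e22
  simp at e22
  have hle : g.1 2 2 ^ 2 ≤ 1 := by nlinarith [sq_nonneg (g.1 0 2), sq_nonneg (g.1 1 2)]
  obtain ⟨hl, hu⟩ := abs_le.1 ((sq_le_one_iff_abs_le_one _).1 hle)
  set β := Real.arccos (g.1 2 2) with hβ
  have hcos : Real.cos β = g.1 2 2 := Real.cos_arccos hl hu
  have hsc := Real.sin_sq_add_cos_sq β
  obtain ⟨α, hα, hx, hy⟩ : ∃ α ∈ Set.Ico 0 (2 * Real.pi),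
      Real.sin β * Real.cos α = g.1 0 2 ∧ Real.sin β * Real.sin α = g.1 1 2 := by
    by_cases hs : Real.sin β = 0
    · have h0 : g.1 0 2 ^ 2 + g.1 1 2 ^ 2 = 0 := by
        rw [hs, hcos] at hsc
        nlinarith
      have h1 : g.1 0 2 = 0 := by nlinarith [sq_nonneg (g.1 0 2), sq_nonneg (g.1 1 2)]
      have h2 : g.1 1 2 = 0 := by nlinarith [sq_nonneg (g.1 0 2), sq_nonneg (g.1 1 2)]
      exact ⟨0, ⟨le_refl _, Real.two_pi_pos⟩, by simp [hs, h1], by simp [hs, h2]⟩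
    · obtain ⟨α, hα, hc, hd⟩ := exists_angle (a := g.1 0 2 / Real.sin β)
        (b := g.1 1 2 / Real.sin β) (by
          rw [div_pow, div_pow, ← add_div, div_eq_one_iff_eq (pow_ne_zero 2 hs)]
          rw [hcos] at hsc
          linarith)
      exact ⟨α, hα, by rw [hc, mul_div_cancel₀ _ hs], by rw [hd, mul_div_cancel₀ _ hs]⟩
  have hk : ((rotZ α * rotY β)⁻¹ * g).1 = (rotZ α * rotY β).1ᵀ * g.1 := rfl
  have hm : (rotZ α * rotY β).1 = !![Real.cos α, -Real.sin α, 0; Real.sin α, Real.cos α, 0; 0, 0, 1]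
      * !![Real.cos β, 0, Real.sin β; 0, 1, 0; -Real.sin β, 0, Real.cos β] := rfl
  have hα2 := Real.sin_sq_add_cos_sq α
  obtain ⟨γ, hγ, hg⟩ := exists_rotZ (h := (rotZ α * rotY β)⁻¹ * g)
    (by
      rw [hk, hm]
      simp [Matrix.mul_apply, Fin.sum_univ_three, ← hx, ← hy, ← hcos]
      linear_combination Real.sin β * Real.cos β * hα2)
    (by
      rw [hk, hm]
      simp [Matrix.mul_apply, Fin.sum_univ_three, ← hx, ← hy, ← hcos]
      ring)
    (by
      rw [hk, hm]
      simp [Matrix.mul_apply, Fin.sum_univ_three, ← hx, ← hy, ← hcos]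
      linear_combination Real.sin β ^ 2 * hα2 + hsc)
  exact ⟨(α, β, γ), hα, ⟨Real.arccos_nonneg _, Real.arccos_le_pi _⟩, hγ, by
    rw [← hg, mul_inv_cancel_left]⟩

/-- ZYZ Euler angles of a rotation. They are unique unless `β ∈ {0, π}`, and the value of the
Wigner functions does not depend on the choice. -/
def eulerAngles (g : SO3) : ℝ × ℝ × ℝ := (exists_isEuler g).choose

/-- The Wigner `d`-function `d^ℓ_{m,m'}(β)` for integers `|m|, |m'| ≤ ℓ`, by Wigner's formula
`√((ℓ+m)! (ℓ-m)! (ℓ+m')! (ℓ-m')!) ∑ s, (-1)^{m-m'+s} cos(β/2)^{2ℓ+m'-m-2s} sin(β/2)^{m-m'+2s}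
/ ((ℓ+m'-s)! s! (m-m'+s)! (ℓ-m-s)!)`, the sum being over all `s` for which the arguments of the
factorials are nonnegative. -/
def wignerSmallD (l : ℕ) (m m' : ℤ) (β : ℝ) : ℝ :=
  Real.sqrt ((l + m).toNat ! * (l - m).toNat ! * (l + m').toNat ! * (l - m').toNat !) *
    ∑ s ∈ Finset.Icc (max 0 (m' - m)) (min (l + m') (l - m)),
      (-1) ^ (m - m' + s).toNat * Real.cos (β / 2) ^ (2 * l + m' - m - 2 * s).toNat *
        Real.sin (β / 2) ^ (m - m' + 2 * s).toNat /
        ((l + m' - s).toNat ! * s.toNat ! * (m - m' + s).toNat ! * (l - m - s).toNat !)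

/-- The Wigner function `D^ℓ_{m,m'}(g) = e^{-imα} d^ℓ_{m,m'}(β) e^{-im'γ}`, where `(α, β, γ)` are
ZYZ Euler angles of `g`. -/
def wignerD (l : ℕ) (m m' : ℤ) (g : SO3) : ℂ :=
  Complex.exp (-Complex.I * m * (eulerAngles g).1) * wignerSmallD l m m' (eulerAngles g).2.1 *
    Complex.exp (-Complex.I * m' * (eulerAngles g).2.2)

/-- The space `Π_L` of functions of bandwidth at most `L`. -/
def bandlimited (L : ℕ) : Submodule ℂ (SO3 → ℂ) :=
  Submodule.span ℂ {D | ∃ (l : ℕ) (m m' : ℤ), l ≤ L ∧ |m| ≤ l ∧ |m'| ≤ l ∧ D = wignerD l m m'}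

end SO3Bernstein

end

/-!
A function of bandwidth `L` is the restriction to `SO(3)` of a polynomial of degree at most `L` in
the nine matrix entries. Indeed every summand of `D^ℓ` is a monomial of degree `2ℓ` in the four
Cayley–Klein parameters of the rotation (`cayleyKlein_monomial_eq`), and a product of two of these
parameters is an affine function of the matrix entries (`spinSpan_mul_spinSpan_le`); grouping the
`2ℓ` factors in pairs gives `bandlimited_le`. Hence smoothness and boundedness.

By Rodrigues' formula the entries of `g exp(tA)`, for `A` the generator of a coordinate rotation,
are trigonometric polynomials in `t` of degree at most one, so `t ↦ F (g exp(tA))` is a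
trigonometric polynomial of degree at most `L`, and a Bernstein inequality on the circle gives
`|X_A F| ≤ 7 (1 + L) ‖F‖_∞` (`norm_lieDeriv_gen_le`). The circle version, with a non-optimal
constant, follows from the maximum principle and Cauchy's estimate
(`norm_deriv_le_of_mem_trigSpan_pow`). Since `X_A F` is again a polynomial of degree at most `L`
(`lieDeriv_mem_entrySpan_pow`), second derivatives are bounded by iterating.

For a left-invariant metric the Gram matrix and the connection coefficients in the left-invariant
frame are constant (`gram_eq`, `christoffel_eq`), and the norm of the metric is equivalent to the
maximum norm of the components. So the gradient and the Hessian are bounded by the derivatives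
along the frame, with constants that depend only on the metric.
-/

noncomputable section

namespace SO3Bernstein

/-! ### Bernstein's inequality for trigonometric polynomials -/

theorem norm_eval_le_of_norm_le_one (p : Polynomial ℂ) {M : ℝ}
    (h : ∀ z : ℂ, ‖z‖ = 1 → ‖p.eval z‖ ≤ M) {z : ℂ} (hz : ‖z‖ ≤ 1) : ‖p.eval z‖ ≤ M := by
  refine Complex.norm_le_of_forall_mem_frontier_norm_le (U := Metric.ball (0 : ℂ) 1)
    (f := fun z => p.eval z) Metric.isBounded_ball p.differentiable.diffContOnCl ?_ ?_
  · intro w hw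
    rw [frontier_ball _ one_ne_zero, mem_sphere_zero_iff_norm] at hw
    exact h w hw
  · rw [closure_ball _ one_ne_zero, mem_closedBall_zero_iff]
    exact hz

/-- Growth outside the unit disc: the maximum principle for the reversed polynomial
`z ^ n * p (1 / z)`. -/
theorem norm_eval_le_of_one_le_norm (p : Polynomial ℂ) {n : ℕ} (hn : p.natDegree ≤ n) {M : ℝ}
    (h : ∀ z : ℂ, ‖z‖ = 1 → ‖p.eval z‖ ≤ M) {z : ℂ} (hz : 1 ≤ ‖z‖) :
    ‖p.eval z‖ ≤ M * ‖z‖ ^ n := by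
  have key : ∀ w : ℂ, w ≠ 0 → (p.reflect n).eval w⁻¹ * w ^ n = p.eval w := by
    intro w hw
    let _ : Invertible w := invertibleOfNonzero hw
    have := Polynomial.eval₂_reflect_mul_pow (RingHom.id ℂ) w n p hn
    rwa [invOf_eq_inv] at this
  have hz0 : z ≠ 0 := norm_pos_iff.1 (by linarith)
  rw [← key z hz0, norm_mul, norm_pow]
  refine mul_le_mul_of_nonneg_right (norm_eval_le_of_norm_le_one _ (fun w hw => ?_) ?_)
    (by positivity)
  · have hw0 : w ≠ 0 := norm_pos_iff.1 (by linarith)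
    have e := key w⁻¹ (inv_ne_zero hw0)
    rw [inv_inv] at e
    have := h w⁻¹ (by rw [norm_inv, hw, inv_one])
    rwa [← e, norm_mul, norm_pow, norm_inv, hw, inv_one, one_pow, mul_one] at this
  · rw [norm_inv]
    exact inv_le_one_of_one_le₀ hz

/-- Bernstein's inequality for polynomials on the unit circle, up to a constant: Cauchy's estimate
on a disc of radius `1 / (n + 1)`, on which `p` grows at most by the factor `exp 1`. -/
theorem norm_eval_derivative_le (p : Polynomial ℂ) {n : ℕ} (hn : p.natDegree ≤ n) {M : ℝ}
    (h : ∀ z : ℂ, ‖z‖ = 1 → ‖p.eval z‖ ≤ M) {z : ℂ} (hz : ‖z‖ = 1) :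
    ‖p.derivative.eval z‖ ≤ 3 * (n + 1) * M := by
  have hM : 0 ≤ M := (norm_nonneg _).trans (h z hz)
  have hr : (0 : ℝ) < 1 / (n + 1) := by positivity
  have hpow : (1 + 1 / ((n : ℝ) + 1)) ^ n ≤ 3 := by
    calc (1 + 1 / ((n : ℝ) + 1)) ^ n ≤ Real.exp (1 / (n + 1)) ^ n := by
          gcongr
          rw [add_comm]
          exact Real.add_one_le_exp _
      _ = Real.exp (n * (1 / (n + 1))) := (Real.exp_nat_mul _ _).symm
      _ ≤ Real.exp 1 := by
          gcongr
          rw [mul_one_div, div_le_one (by positivity)]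
          linarith
      _ ≤ 3 := (Real.exp_one_lt_d9.trans (by norm_num)).le
  have key : ∀ w ∈ Metric.sphere z (1 / ((n : ℝ) + 1)), ‖p.eval w‖ ≤ 3 * M := by
    intro w hw
    rcases le_total ‖w‖ 1 with h1 | h1
    · exact (norm_eval_le_of_norm_le_one p h h1).trans (by linarith)
    · have hw' : ‖w‖ ≤ 1 + 1 / ((n : ℝ) + 1) := by
        rw [mem_sphere_iff_norm] at hw
        have := norm_add_le z (w - z)
        rwa [add_sub_cancel, hz, hw] at this
      calc ‖p.eval w‖ ≤ M * ‖w‖ ^ n := norm_eval_le_of_one_le_norm p hn h h1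
        _ ≤ M * (1 + 1 / ((n : ℝ) + 1)) ^ n := by gcongr
        _ ≤ M * 3 := by gcongr
        _ = 3 * M := mul_comm _ _
  have := Complex.norm_deriv_le_of_forall_mem_sphere_norm_le (f := fun w => p.eval w) hr
    p.differentiable.diffContOnCl key
  rw [Polynomial.deriv] at this
  refine this.trans (le_of_eq ?_)
  field_simp

/-- The trigonometric polynomials of degree at most one. Those of degree at most `L` form its
`L`-th power in the algebra of functions on `ℝ`. -/
def trigSpan : Submodule ℂ (ℝ → ℂ) :=
  Submodule.span ℂ {fun t : ℝ => Complex.exp (t * Complex.I), 1,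
    fun t : ℝ => Complex.exp (-(t * Complex.I))}

theorem trigSpan_pow_eq {L : ℕ} {f : ℝ → ℂ} (hf : f ∈ trigSpan ^ L) :
    ∃ p : Polynomial ℂ, p.natDegree ≤ 2 * L ∧
      ∀ t : ℝ, f t = Complex.exp (-(t * Complex.I)) ^ L * p.eval (Complex.exp (t * Complex.I)) := by
  have hinv : ∀ t : ℝ, Complex.exp (-(t * Complex.I)) * Complex.exp (t * Complex.I) = 1 := by
    intro t
    rw [← Complex.exp_add, neg_add_cancel, Complex.exp_zero]
  induction hf using Submodule.pow_induction_on_left' with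
  | algebraMap r => exact ⟨Polynomial.C r, by simp, fun t => by simp⟩
  | add x y i hx hy ihx ihy =>
    obtain ⟨p, hp, hp'⟩ := ihx
    obtain ⟨q, hq, hq'⟩ := ihy
    refine ⟨p + q, (Polynomial.natDegree_add_le _ _).trans (max_le hp hq), fun t => ?_⟩
    rw [Pi.add_apply, hp', hq', Polynomial.eval_add, mul_add]
  | mem_mul m hm i x hx ih =>
    obtain ⟨p, hp, hp'⟩ := ih
    obtain ⟨a, b, c, rfl⟩ := Submodule.mem_span_triple.1 hm
    refine ⟨(Polynomial.C a * Polynomial.X ^ 2 + Polynomial.C b * Polynomial.X + Polynomial.C c) * p,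
      ?_, fun t => ?_⟩
    · refine Polynomial.natDegree_mul_le.trans ?_
      have := Polynomial.natDegree_quadratic_le (a := a) (b := b) (c := c)
      rw [Nat.succ_eq_add_one]
      omega
    · have e := hinv t
      simp only [Pi.mul_apply, Pi.add_apply, Pi.smul_apply, Pi.one_apply, smul_eq_mul, hp',
        Polynomial.eval_mul, Polynomial.eval_add, Polynomial.eval_C, Polynomial.eval_pow,
        Polynomial.eval_X, pow_succ]
      generalize Complex.exp (-(t * Complex.I)) = u at *
      generalize Complex.exp (t * Complex.I) = v at *
      linear_combination (-(u ^ i * Polynomial.eval v p) * (a * v + b)) * e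

/-- Bernstein's inequality for trigonometric polynomials, up to a constant. -/
theorem norm_deriv_le_of_mem_trigSpan_pow {L : ℕ} {f : ℝ → ℂ} (hf : f ∈ trigSpan ^ L) {M : ℝ}
    (hM : ∀ t, ‖f t‖ ≤ M) (t : ℝ) : ‖deriv f t‖ ≤ 7 * (1 + L) * M := by
  obtain ⟨p, hp, hfp⟩ := trigSpan_pow_eq hf
  have hM0 : 0 ≤ M := (norm_nonneg _).trans (hM 0)
  have hu : ∀ t : ℝ, ‖Complex.exp (t * Complex.I)‖ = 1 := Complex.norm_exp_ofReal_mul_I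
  have hu' : ∀ t : ℝ, ‖Complex.exp (-(t * Complex.I))‖ = 1 := fun t => by
    simpa using Complex.norm_exp_ofReal_mul_I (-t)
  have hpM : ∀ z : ℂ, ‖z‖ = 1 → ‖p.eval z‖ ≤ M := by
    intro z hz
    have e : Complex.exp (z.arg * Complex.I) = z := by
      simpa [hz] using Complex.norm_mul_exp_arg_mul_I z
    have := hM z.arg
    rwa [hfp, norm_mul, norm_pow, hu', one_pow, one_mul, e] at this
  have h1 : HasDerivAt (fun t : ℝ => Complex.exp (t * Complex.I))
      (Complex.exp (t * Complex.I) * (1 * Complex.I)) t :=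
    ((Complex.ofRealCLM.hasDerivAt (x := t)).mul_const Complex.I).cexp
  have h2 : HasDerivAt (fun t : ℝ => Complex.exp (-(t * Complex.I)))
      (Complex.exp (-(t * Complex.I)) * (-(1 * Complex.I))) t :=
    ((Complex.ofRealCLM.hasDerivAt (x := t)).mul_const Complex.I).neg.cexp
  have h3 : HasDerivAt (fun t : ℝ => p.eval (Complex.exp (t * Complex.I)))
      (p.derivative.eval (Complex.exp (t * Complex.I)) *
        (Complex.exp (t * Complex.I) * (1 * Complex.I))) t :=
    (p.hasDerivAt _).comp t h1
  have h4 := (h2.pow L).mul h3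
  have hf' : f = (fun t : ℝ => Complex.exp (-(t * Complex.I))) ^ L *
      fun t : ℝ => p.eval (Complex.exp (t * Complex.I)) := funext hfp
  rw [hf', h4.deriv]
  refine (norm_add_le _ _).trans ?_
  have hd := norm_eval_derivative_le p hp hpM (hu t)
  have hp' := hpM _ (hu t)
  simp only [norm_mul, norm_pow, norm_neg, Pi.pow_apply, hu, hu', one_pow, Complex.norm_I,
    mul_one, one_mul, Complex.norm_natCast]
  push_cast at hd
  have : (L : ℝ) * ‖p.eval (Complex.exp (t * Complex.I))‖ ≤ L * M := by gcongr
  nlinarith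

/-! ### Polynomials in the matrix entries -/

/-- The functions on `SO(3)` that are affine in the matrix entries. The restrictions to `SO(3)` of
the polynomials of degree at most `L` form its `L`-th power in the algebra of functions. -/
def entrySpan : Submodule ℂ (SO3 → ℂ) :=
  Submodule.span ℂ (insert 1 (Set.range fun (ij : Fin 3 × Fin 3) (g : SO3) =>
    ((g.1 ij.1 ij.2 : ℝ) : ℂ)))

theorem one_mem_entrySpan : (1 : SO3 → ℂ) ∈ entrySpan :=
  Submodule.subset_span (Set.mem_insert _ _)

theorem entry_mem_entrySpan (i j : Fin 3) :
    (fun g : SO3 => ((g.1 i j : ℝ) : ℂ)) ∈ entrySpan :=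
  Submodule.subset_span (Set.mem_insert_of_mem _ ⟨(i, j), rfl⟩)

/-- Induction over the polynomials in the matrix entries, forgetting degrees. -/
theorem entrySpan_pow_induction {C : (SO3 → ℂ) → Prop} (hconst : ∀ c : ℂ, C fun _ => c)
    (hentry : ∀ i j, C fun g => ((g.1 i j : ℝ) : ℂ)) (hadd : ∀ F G, C F → C G → C (F + G))
    (hmul : ∀ F G, C F → C G → C (F * G)) {L : ℕ} {F : SO3 → ℂ} (hF : F ∈ entrySpan ^ L) : C F := by
  refine Submodule.pow_induction_on_left entrySpan (C := C) hconst hadd ?_ hF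
  intro G hG F hF
  refine hmul G F ?_ hF
  induction hG using Submodule.span_induction with
  | mem x hx =>
    rcases hx with rfl | ⟨ij, rfl⟩
    · exact hconst 1
    · exact hentry _ _
  | zero => exact hconst 0
  | add x y _ _ hx hy => exact hadd x y hx hy
  | smul a x _ hx => exact hmul _ _ (hconst a) hx

theorem isSmooth_of_mem_entrySpan_pow {L : ℕ} {F : SO3 → ℂ} (hF : F ∈ entrySpan ^ L) :
    IsSmooth F := by
  refine entrySpan_pow_induction (C := IsSmooth)
    (fun c => ⟨fun _ => c, contDiff_const, fun _ => rfl⟩) (fun i j => ?_) ?_ ?_ hF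
  · refine ⟨fun x => ((x i j : ℝ) : ℂ), ?_, fun _ => rfl⟩
    exact Complex.ofRealCLM.contDiff.comp (contDiff_apply_apply ℝ ℝ i j)
  · rintro F G ⟨F', hF', eF⟩ ⟨G', hG', eG⟩
    exact ⟨_, hF'.add hG', fun g => by rw [Pi.add_apply, eF, eG]⟩
  · rintro F G ⟨F', hF', eF⟩ ⟨G', hG', eG⟩
    exact ⟨_, hF'.mul hG', fun g => by rw [Pi.mul_apply, eF, eG]⟩

theorem abs_entry_le_one (g : SO3) (i j : Fin 3) : |g.1 i j| ≤ 1 :=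
  entry_norm_bound_of_unitary (𝕜 := ℝ) g.2.1 i j

theorem exists_norm_le_of_mem_entrySpan_pow {L : ℕ} {F : SO3 → ℂ} (hF : F ∈ entrySpan ^ L) :
    ∃ M, ∀ g, ‖F g‖ ≤ M := by
  refine entrySpan_pow_induction (C := fun F => ∃ M, ∀ g, ‖F g‖ ≤ M)
    (fun c => ⟨‖c‖, fun _ => le_rfl⟩)
    (fun i j => ⟨1, fun g => ?_⟩) ?_ ?_ hF
  · rw [Complex.norm_real]
    exact abs_entry_le_one g i j
  · rintro F G ⟨a, ha⟩ ⟨b, hb⟩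
    exact ⟨a + b, fun g => (norm_add_le _ _).trans (add_le_add (ha g) (hb g))⟩
  · rintro F G ⟨a, ha⟩ ⟨b, hb⟩
    refine ⟨a * b, fun g => ?_⟩
    rw [Pi.mul_apply, norm_mul]
    exact mul_le_mul (ha g) (hb g) (norm_nonneg _) ((norm_nonneg _).trans (ha g))

/-! ### Derivatives along left-invariant fields -/

section MatrixNorm

open scoped Matrix.Norms.Operator

theorem hasDerivAt_exp_smul (A : Mat3) (t : ℝ) :
    HasDerivAt (fun t : ℝ => NormedSpace.exp (t • A)) (NormedSpace.exp (t • A) * A) t :=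
  hasDerivAt_exp_smul_const A t

theorem hasDerivAt_entry (A : so3) (g : SO3) (i j : Fin 3) :
    HasDerivAt (fun t : ℝ => (((g * expSO (t • A)).1 i j : ℝ) : ℂ))
      (((g.1 * A.1) i j : ℝ) : ℂ) 0 := by
  have h := (hasDerivAt_exp_smul A.1 0).const_mul g.1
  rw [zero_smul, NormedSpace.exp_zero, one_mul] at h
  exact (hasDerivAt_pi.1 (hasDerivAt_pi.1 h i) j).ofReal_comp

/-- Rodrigues' formula in a Banach algebra. -/
theorem exp_smul_eq_of_cube_eq_neg {𝔸 : Type*} [NormedRing 𝔸] [NormedAlgebra ℝ 𝔸]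
    [CompleteSpace 𝔸] (A : 𝔸) (hA : A * (A * A) = -A) (t : ℝ) :
    NormedSpace.exp (t • A) = 1 + Real.sin t • A + (1 - Real.cos t) • (A * A) := by
  set R : ℝ → 𝔸 := fun t => 1 + Real.sin t • A + (1 - Real.cos t) • (A * A) with hR
  -- `R` solves the differential equation of `exp (t • A)`, so `exp (-(t • A)) * R t` is constant.
  have hR' : ∀ t, HasDerivAt R (A * R t) t := by
    intro t
    have h : HasDerivAt R _ t := (((Real.hasDerivAt_sin t).smul_const A).const_add 1).add
      (((Real.hasDerivAt_cos t).const_sub 1).smul_const (A * A))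
    convert h using 1
    simp only [hR, mul_add, mul_one, mul_smul_comm, hA]
    module
  have hd : ∀ t : ℝ, HasDerivAt (fun t => NormedSpace.exp (t • (-A)) * R t) 0 t := by
    intro t
    have h : HasDerivAt (fun t => NormedSpace.exp (t • (-A)) * R t) _ t :=
      (hasDerivAt_exp_smul_const (𝕂 := ℝ) (-A) t).mul (hR' t)
    convert h using 1
    simp only [mul_assoc, neg_mul, mul_neg, neg_add_cancel]
  have hc := is_const_of_deriv_eq_zero (fun t => (hd t).differentiableAt)
    (fun t => (hd t).deriv) t 0
  have h0 : R 0 = 1 := by simp [hR]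
  rw [h0, zero_smul, NormedSpace.exp_zero, mul_one] at hc
  have hi : NormedSpace.exp (t • A) * NormedSpace.exp (t • (-A)) = 1 := by
    let _ : NormedAlgebra ℚ 𝔸 := NormedAlgebra.restrictScalars ℚ ℝ 𝔸
    rw [smul_neg, ← NormedSpace.exp_add_of_commute (Commute.refl _).neg_right, add_neg_cancel,
      NormedSpace.exp_zero]
  calc NormedSpace.exp (t • A) = NormedSpace.exp (t • A) * (NormedSpace.exp (t • (-A)) * R t) := by
        rw [hc, mul_one]
    _ = R t := by rw [← mul_assoc, hi, one_mul]

theorem exp_smul_eq (A : Mat3) (hA : A * (A * A) = -A) (t : ℝ) :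
    NormedSpace.exp (t • A) = 1 + Real.sin t • A + (1 - Real.cos t) • (A * A) :=
  exp_smul_eq_of_cube_eq_neg A hA t

end MatrixNorm

/-- A left-invariant field maps polynomials of degree at most `L` to such polynomials. -/
theorem exists_hasDerivAt_of_mem_entrySpan_pow (A : so3) {L : ℕ} {F : SO3 → ℂ}
    (hF : F ∈ entrySpan ^ L) :
    ∃ F' ∈ entrySpan ^ L, ∀ g, HasDerivAt (fun t : ℝ => F (g * expSO (t • A))) (F' g) 0 := by
  have h0 : ∀ g : SO3, g * expSO ((0 : ℝ) • A) = g := by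
    intro g
    have : expSO ((0 : ℝ) • A) = 1 := by
      refine Subtype.ext ?_
      change NormedSpace.exp ((0 : ℝ) • A.1) = 1
      rw [zero_smul, NormedSpace.exp_zero]
    rw [this, mul_one]
  induction hF using Submodule.pow_induction_on_left' with
  | algebraMap r =>
    exact ⟨0, Submodule.zero_mem _, fun g => hasDerivAt_const _ r⟩
  | add x y i hx hy ihx ihy =>
    obtain ⟨x', hx', ex⟩ := ihx
    obtain ⟨y', hy', ey⟩ := ihy
    exact ⟨x' + y', add_mem hx' hy', fun g => (ex g).add (ey g)⟩
  | mem_mul G hG i x hx ih =>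
    obtain ⟨x', hx', ex⟩ := ih
    obtain ⟨G', hG', eG⟩ : ∃ G' ∈ entrySpan,
        ∀ g, HasDerivAt (fun t : ℝ => G (g * expSO (t • A))) (G' g) 0 := by
      clear hx hx' ex
      induction hG using Submodule.span_induction with
      | mem x hx =>
        rcases hx with rfl | ⟨⟨a, b⟩, rfl⟩
        · exact ⟨0, Submodule.zero_mem _, fun g => hasDerivAt_const _ 1⟩
        · refine ⟨∑ c, (A.1 c b : ℂ) • fun g : SO3 => ((g.1 a c : ℝ) : ℂ),
            Submodule.sum_mem _ fun c _ => Submodule.smul_mem _ _ (entry_mem_entrySpan a c),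
            fun g => ?_⟩
          convert hasDerivAt_entry A g a b using 1
          simp [Matrix.mul_apply, mul_comm]
      | zero => exact ⟨0, Submodule.zero_mem _, fun g => hasDerivAt_const _ 0⟩
      | add x y _ _ hx hy =>
        obtain ⟨x', hx', ex⟩ := hx
        obtain ⟨y', hy', ey⟩ := hy
        exact ⟨x' + y', add_mem hx' hy', fun g => (ex g).add (ey g)⟩
      | smul a x _ hx =>
        obtain ⟨x', hx', ex⟩ := hx
        exact ⟨a • x', Submodule.smul_mem _ a hx', fun g => (ex g).const_mul a⟩
    refine ⟨G' * x + G * x', ?_, fun g => ?_⟩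
    · rw [Nat.succ_eq_add_one, pow_succ']
      exact add_mem (Submodule.mul_mem_mul hG' hx) (Submodule.mul_mem_mul hG hx')
    · have := (eG g).mul (ex g)
      simp only [h0] at this
      exact this

theorem lieDeriv_mem_entrySpan_pow (A : so3) {L : ℕ} {F : SO3 → ℂ} (hF : F ∈ entrySpan ^ L) :
    lieDeriv A F ∈ entrySpan ^ L := by
  obtain ⟨F', hF', h⟩ := exists_hasDerivAt_of_mem_entrySpan_pow A hF
  have : lieDeriv A F = F' := funext fun g => (h g).deriv
  rwa [this]

theorem gen_cube (i : Fin 3) : (gen i).1 * ((gen i).1 * (gen i).1) = -(gen i).1 := by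
  fin_cases i <;> ext a b <;> fin_cases a <;> fin_cases b <;>
    simp [gen, Matrix.mul_apply, Fin.sum_univ_three]

theorem cos_mem_trigSpan : (fun t : ℝ => ((Real.cos t : ℝ) : ℂ)) ∈ trigSpan := by
  refine Submodule.mem_span_triple.2 ⟨1 / 2, 0, 1 / 2, funext fun t => ?_⟩
  simp only [Pi.add_apply, Pi.smul_apply, smul_eq_mul, Complex.ofReal_cos, Complex.cos, neg_mul]
  ring

theorem sin_mem_trigSpan : (fun t : ℝ => ((Real.sin t : ℝ) : ℂ)) ∈ trigSpan := by
  refine Submodule.mem_span_triple.2 ⟨-(Complex.I / 2), 0, Complex.I / 2, funext fun t => ?_⟩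
  simp only [Pi.add_apply, Pi.smul_apply, smul_eq_mul, Complex.ofReal_sin, Complex.sin, neg_mul]
  ring

theorem one_mem_trigSpan : (1 : ℝ → ℂ) ∈ trigSpan :=
  Submodule.subset_span (by simp)

/-- Restriction of functions on `SO(3)` to the orbit `t ↦ g exp(tA)`. -/
def alongFlow (A : so3) (g : SO3) : (SO3 → ℂ) →ₐ[ℂ] (ℝ → ℂ) where
  toFun F t := F (g * expSO (t • A))
  map_one' := rfl
  map_mul' _ _ := rfl
  map_zero' := rfl
  map_add' _ _ := rfl
  commutes' _ := rfl

theorem map_alongFlow_entrySpan_le (i : Fin 3) (g : SO3) :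
    entrySpan.map (alongFlow (gen i) g).toLinearMap ≤ trigSpan := by
  rw [Submodule.map_le_iff_le_comap, entrySpan, Submodule.span_le]
  rintro _ (rfl | ⟨⟨a, b⟩, rfl⟩)
  · exact one_mem_trigSpan
  · change (fun t : ℝ => (((g.1 * NormedSpace.exp (t • (gen i).1)) a b : ℝ) : ℂ)) ∈ trigSpan
    have : (fun t : ℝ => (((g.1 * NormedSpace.exp (t • (gen i).1)) a b : ℝ) : ℂ)) =
        ((g.1 a b + (g.1 * ((gen i).1 * (gen i).1)) a b : ℝ) : ℂ) • (1 : ℝ → ℂ)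
          + (((g.1 * (gen i).1) a b : ℝ) : ℂ) • (fun t : ℝ => ((Real.sin t : ℝ) : ℂ))
          - (((g.1 * ((gen i).1 * (gen i).1)) a b : ℝ) : ℂ) •
            (fun t : ℝ => ((Real.cos t : ℝ) : ℂ)) := by
      funext t
      rw [exp_smul_eq _ (gen_cube i) t]
      simp only [mul_add, mul_one, Matrix.mul_smul, Matrix.add_apply, Matrix.smul_apply,
        Pi.add_apply, Pi.sub_apply, Pi.smul_apply, Pi.one_apply, smul_eq_mul]
      push_cast
      ring
    rw [this]
    exact sub_mem (add_mem (Submodule.smul_mem _ _ one_mem_trigSpan)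
      (Submodule.smul_mem _ _ sin_mem_trigSpan)) (Submodule.smul_mem _ _ cos_mem_trigSpan)

/-- Bernstein's inequality on `SO(3)` for the coordinate rotations, whose orbits are
`2π`-periodic. -/
theorem norm_lieDeriv_gen_le (i : Fin 3) {L : ℕ} {F : SO3 → ℂ} (hF : F ∈ entrySpan ^ L) {M : ℝ}
    (hM : ∀ g, ‖F g‖ ≤ M) (g : SO3) : ‖lieDeriv (gen i) F g‖ ≤ 7 * (1 + L) * M := by
  refine norm_deriv_le_of_mem_trigSpan_pow (f := alongFlow (gen i) g F) ?_ (fun t => hM _) 0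
  have h := Submodule.mem_map_of_mem (f := (alongFlow (gen i) g).toLinearMap) hF
  rw [Submodule.map_pow] at h
  exact pow_le_pow_left' (map_alongFlow_entrySpan_le i g) L h

/-! ### Wigner functions as polynomials in the matrix entries -/

open Complex in
/-- The Cayley–Klein parameters `e^{∓i(α+γ)/2} cos(β/2)` and `e^{∓i(α-γ)/2} sin(β/2)` of a rotation
with the chosen Euler angles. They are determined by the rotation only up to a common sign. -/
def cayleyKlein (g : SO3) : Fin 4 → ℂ :=
  let α : ℂ := (eulerAngles g).1
  let β : ℂ := (eulerAngles g).2.1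
  let γ : ℂ := (eulerAngles g).2.2
  ![exp (-(I * (α / 2))) * exp (-(I * (γ / 2))) * cos (β / 2),
    exp (I * (α / 2)) * exp (I * (γ / 2)) * cos (β / 2),
    exp (-(I * (α / 2))) * exp (I * (γ / 2)) * sin (β / 2),
    exp (I * (α / 2)) * exp (-(I * (γ / 2))) * sin (β / 2)]

/-- The span of the four Cayley–Klein parameters. -/
def spinSpan : Submodule ℂ (SO3 → ℂ) :=
  Submodule.span ℂ (Set.range fun k g => cayleyKlein g k)

theorem cayleyKlein_mem (k : Fin 4) : (fun g => cayleyKlein g k) ∈ spinSpan :=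
  Submodule.subset_span ⟨k, rfl⟩

theorem exp_half_mul_self (z : ℂ) :
    Complex.exp (Complex.I * (z / 2)) * Complex.exp (Complex.I * (z / 2)) =
      Complex.cos z + Complex.I * Complex.sin z := by
  rw [← Complex.exp_add, show Complex.I * (z / 2) + Complex.I * (z / 2) = z * Complex.I by ring,
    Complex.exp_mul_I, mul_comm Complex.I]

theorem exp_neg_half_mul_self (z : ℂ) :
    Complex.exp (-(Complex.I * (z / 2))) * Complex.exp (-(Complex.I * (z / 2))) =
      Complex.cos z - Complex.I * Complex.sin z := by
  have h := exp_half_mul_self (-z)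
  rw [neg_div, mul_neg, Complex.cos_neg, Complex.sin_neg, mul_neg, ← sub_eq_add_neg] at h
  exact h

theorem exp_neg_half_mul_exp_half (z : ℂ) :
    Complex.exp (-(Complex.I * (z / 2))) * Complex.exp (Complex.I * (z / 2)) = 1 := by
  rw [← Complex.exp_add, neg_add_cancel, Complex.exp_zero]

/-- The algebraic relations between the exponentials of the half Euler angles, the Cayley–Klein
parameters and the entries of a rotation. -/
theorem exists_half_angles (g : SO3) : ∃ a a' c c' C S x y z w : ℂ,
    (a * a = x - Complex.I * y ∧ a' * a' = x + Complex.I * y ∧ a * a' = 1) ∧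
    (c * c = z - Complex.I * w ∧ c' * c' = z + Complex.I * w ∧ c * c' = 1) ∧
    S * S = 1 - C * C ∧
    cayleyKlein g = ![a * c * C, a' * c' * C, a * c' * S, a' * c * S] ∧
    g.1.map Complex.ofReal =
      !![x * (2 * (C * C) - 1) * z - y * w, -(x * (2 * (C * C) - 1) * w) - y * z, x * (2 * S * C);
        y * (2 * (C * C) - 1) * z + x * w, -(y * (2 * (C * C) - 1) * w) + x * z, y * (2 * S * C);
        -(2 * S * C * z), 2 * S * C * w, 2 * (C * C) - 1] := by
  refine ⟨_, _, _, _, _, _, _, _, _, _,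
    ⟨exp_neg_half_mul_self (eulerAngles g).1, exp_half_mul_self _, exp_neg_half_mul_exp_half _⟩,
    ⟨exp_neg_half_mul_self (eulerAngles g).2.2, exp_half_mul_self _, exp_neg_half_mul_exp_half _⟩,
    ?_, rfl, ?_⟩
  · linear_combination Complex.sin_sq_add_cos_sq ((eulerAngles g).2.1 / 2 : ℂ)
  · have e : g.1 = !![Real.cos (eulerAngles g).1, -Real.sin (eulerAngles g).1, 0;
        Real.sin (eulerAngles g).1, Real.cos (eulerAngles g).1, 0; 0, 0, 1] *
      !![Real.cos (eulerAngles g).2.1, 0, Real.sin (eulerAngles g).2.1; 0, 1, 0;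
        -Real.sin (eulerAngles g).2.1, 0, Real.cos (eulerAngles g).2.1] *
      !![Real.cos (eulerAngles g).2.2, -Real.sin (eulerAngles g).2.2, 0;
        Real.sin (eulerAngles g).2.2, Real.cos (eulerAngles g).2.2, 0; 0, 0, 1] :=
      congrArg Subtype.val (exists_isEuler g).choose_spec.2.2.2
    have hc : 2 * (Complex.cos ((eulerAngles g).2.1 / 2) * Complex.cos ((eulerAngles g).2.1 / 2)) - 1
        = Complex.cos (eulerAngles g).2.1 := by
      rw [← pow_two, ← Complex.cos_two_mul, mul_div_cancel₀ _ two_ne_zero]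
    have hs : 2 * Complex.sin ((eulerAngles g).2.1 / 2) * Complex.cos ((eulerAngles g).2.1 / 2)
        = Complex.sin (eulerAngles g).2.1 := by
      rw [← Complex.sin_two_mul, mul_div_cancel₀ _ two_ne_zero]
    rw [hc, hs, e]
    ext i j
    fin_cases i <;> fin_cases j <;>
      simp [sub_eq_add_neg]

theorem affine_mem_entrySpan (r : ℂ) (A : Matrix (Fin 3) (Fin 3) ℂ) :
    (fun g : SO3 => r + ∑ i, ∑ j, A i j * g.1.map Complex.ofReal i j) ∈ entrySpan := by
  have : (fun g : SO3 => r + ∑ i, ∑ j, A i j * g.1.map Complex.ofReal i j) =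
      r • 1 + ∑ i, ∑ j, A i j • fun g : SO3 => ((g.1 i j : ℝ) : ℂ) := by
    funext g
    simp
  rw [this]
  exact add_mem (Submodule.smul_mem _ _ one_mem_entrySpan) (Submodule.sum_mem _ fun i _ =>
    Submodule.sum_mem _ fun j _ => Submodule.smul_mem _ _ (entry_mem_entrySpan i j))

open Complex in
/-- The products of two Cayley–Klein parameters are the entries of the rotation up to a complex
change of coordinates; the determinant relation of `SU(2)` accounts for the constants. -/
theorem spinSpan_mul_spinSpan_le : spinSpan * spinSpan ≤ entrySpan := by
  have key : ∀ (i j : Fin 4) (r : ℂ) (A : Matrix (Fin 3) (Fin 3) ℂ),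
      (∀ g, cayleyKlein g i * cayleyKlein g j =
        r + ∑ i, ∑ j, A i j * g.1.map ofReal i j) →
      (fun g => cayleyKlein g i) * (fun g => cayleyKlein g j) ∈ entrySpan := by
    intro i j r A h
    have e : (fun g => cayleyKlein g i) * (fun g => cayleyKlein g j) = _ := funext h
    rw [e]
    exact affine_mem_entrySpan r A
  have hI := I_mul_I
  have h00 := key 0 0 0 !![1 / 2, I / 2, 0; -(I / 2), 1 / 2, 0; 0, 0, 0] fun g => by
    obtain ⟨a, a', c, c', C, S, x, y, z, w, ⟨h1, h2, h3⟩, ⟨h4, h5, h6⟩, h7, h8, h9⟩ :=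
      exists_half_angles g
    rw [h8, h9]
    simp [Fin.sum_univ_three]
    linear_combination c * c * C * C * h1 + (x - I * y) * C * C * h4 + y * w * C * C * hI
  have h01 := key 0 1 (1 / 2) !![0, 0, 0; 0, 0, 0; 0, 0, 1 / 2] fun g => by
    obtain ⟨a, a', c, c', C, S, x, y, z, w, ⟨h1, h2, h3⟩, ⟨h4, h5, h6⟩, h7, h8, h9⟩ :=
      exists_half_angles g
    rw [h8, h9]
    simp [Fin.sum_univ_three]
    linear_combination c * c' * C * C * h3 + C * C * h6
  have h02 := key 0 2 0 !![0, 0, 1 / 2; 0, 0, -(I / 2); 0, 0, 0] fun g => by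
    obtain ⟨a, a', c, c', C, S, x, y, z, w, ⟨h1, h2, h3⟩, ⟨h4, h5, h6⟩, h7, h8, h9⟩ :=
      exists_half_angles g
    rw [h8, h9]
    simp [Fin.sum_univ_three]
    linear_combination c * c' * C * S * h1 + (x - I * y) * C * S * h6
  have h03 := key 0 3 0 !![0, 0, 0; 0, 0, 0; -(1 / 2), -(I / 2), 0] fun g => by
    obtain ⟨a, a', c, c', C, S, x, y, z, w, ⟨h1, h2, h3⟩, ⟨h4, h5, h6⟩, h7, h8, h9⟩ :=
      exists_half_angles g
    rw [h8, h9]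
    simp [Fin.sum_univ_three]
    linear_combination c * c * C * S * h3 + C * S * h4
  have h11 := key 1 1 0 !![1 / 2, -(I / 2), 0; I / 2, 1 / 2, 0; 0, 0, 0] fun g => by
    obtain ⟨a, a', c, c', C, S, x, y, z, w, ⟨h1, h2, h3⟩, ⟨h4, h5, h6⟩, h7, h8, h9⟩ :=
      exists_half_angles g
    rw [h8, h9]
    simp [Fin.sum_univ_three]
    linear_combination c' * c' * C * C * h2 + (x + I * y) * C * C * h5 + y * w * C * C * hI
  have h12 := key 1 2 0 !![0, 0, 0; 0, 0, 0; -(1 / 2), I / 2, 0] fun g => by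
    obtain ⟨a, a', c, c', C, S, x, y, z, w, ⟨h1, h2, h3⟩, ⟨h4, h5, h6⟩, h7, h8, h9⟩ :=
      exists_half_angles g
    rw [h8, h9]
    simp [Fin.sum_univ_three]
    linear_combination c' * c' * C * S * h3 + C * S * h5
  have h13 := key 1 3 0 !![0, 0, 1 / 2; 0, 0, I / 2; 0, 0, 0] fun g => by
    obtain ⟨a, a', c, c', C, S, x, y, z, w, ⟨h1, h2, h3⟩, ⟨h4, h5, h6⟩, h7, h8, h9⟩ :=
      exists_half_angles g
    rw [h8, h9]
    simp [Fin.sum_univ_three]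
    linear_combination c * c' * C * S * h2 + (x + I * y) * C * S * h6
  have h22 := key 2 2 0 !![-(1 / 2), I / 2, 0; I / 2, 1 / 2, 0; 0, 0, 0] fun g => by
    obtain ⟨a, a', c, c', C, S, x, y, z, w, ⟨h1, h2, h3⟩, ⟨h4, h5, h6⟩, h7, h8, h9⟩ :=
      exists_half_angles g
    rw [h8, h9]
    simp [Fin.sum_univ_three]
    linear_combination c' * c' * S * S * h1 + (x - I * y) * S * S * h5 - y * w * S * S * hI
      + (x * z + y * w + I * (x * w - y * z)) * h7
  have h23 := key 2 3 (1 / 2) !![0, 0, 0; 0, 0, 0; 0, 0, -(1 / 2)] fun g => by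
    obtain ⟨a, a', c, c', C, S, x, y, z, w, ⟨h1, h2, h3⟩, ⟨h4, h5, h6⟩, h7, h8, h9⟩ :=
      exists_half_angles g
    rw [h8, h9]
    simp [Fin.sum_univ_three]
    linear_combination c * c' * S * S * h3 + S * S * h6 + h7
  have h33 := key 3 3 0 !![-(1 / 2), -(I / 2), 0; -(I / 2), 1 / 2, 0; 0, 0, 0] fun g => by
    obtain ⟨a, a', c, c', C, S, x, y, z, w, ⟨h1, h2, h3⟩, ⟨h4, h5, h6⟩, h7, h8, h9⟩ :=
      exists_half_angles g
    rw [h8, h9]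
    simp [Fin.sum_univ_three]
    linear_combination c * c * S * S * h2 + (x + I * y) * S * S * h4 - y * w * S * S * hI
      + (x * z + y * w - I * (x * w - y * z)) * h7
  rw [spinSpan, Submodule.span_mul_span, Submodule.span_le]
  rintro _ ⟨_, ⟨i, rfl⟩, _, ⟨j, rfl⟩, rfl⟩
  change (fun g => cayleyKlein g i) * (fun g => cayleyKlein g j) ∈ entrySpan
  fin_cases i <;> fin_cases j <;> first | assumption | (rw [mul_comm]; assumption)

theorem monomial_mem_entrySpan_pow {p q r t l : ℕ} (h : p + q + r + t = 2 * l) :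
    (fun g => cayleyKlein g 0 ^ p * cayleyKlein g 1 ^ q * cayleyKlein g 2 ^ r *
      cayleyKlein g 3 ^ t) ∈ entrySpan ^ l := by
  have h1 : (fun g => cayleyKlein g 0 ^ p * cayleyKlein g 1 ^ q * cayleyKlein g 2 ^ r *
      cayleyKlein g 3 ^ t) ∈ spinSpan ^ (2 * l) := by
    rw [← h, pow_add, pow_add, pow_add]
    exact Submodule.mul_mem_mul (Submodule.mul_mem_mul (Submodule.mul_mem_mul
      (Submodule.pow_mem_pow _ (cayleyKlein_mem 0) p) (Submodule.pow_mem_pow _ (cayleyKlein_mem 1) q))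
      (Submodule.pow_mem_pow _ (cayleyKlein_mem 2) r)) (Submodule.pow_mem_pow _ (cayleyKlein_mem 3) t)
  rw [pow_mul, pow_two] at h1
  exact pow_le_pow_left' spinSpan_mul_spinSpan_le l h1

/-- The summands of a Wigner function are monomials in the Cayley–Klein parameters. -/
theorem cayleyKlein_monomial_eq {p q r t : ℕ} {m m' : ℤ} (hm : 2 * m = p + r - q - t)
    (hm' : 2 * m' = p + t - q - r) (g : SO3) :
    cayleyKlein g 0 ^ p * cayleyKlein g 1 ^ q * cayleyKlein g 2 ^ r * cayleyKlein g 3 ^ t =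
      Complex.exp (-Complex.I * m * (eulerAngles g).1) *
      (Complex.cos ((eulerAngles g).2.1 / 2) ^ (p + q) *
        Complex.sin ((eulerAngles g).2.1 / 2) ^ (r + t)) *
      Complex.exp (-Complex.I * m' * (eulerAngles g).2.2) := by
  have aux : ∀ (n : ℤ) (i j : ℕ) (z : ℂ), 2 * n = i - j →
      Complex.exp (-Complex.I * n * z) =
        Complex.exp (-(Complex.I * (z / 2))) ^ i * Complex.exp (Complex.I * (z / 2)) ^ j := by
    intro n i j z h
    have h' : (2 : ℂ) * n = i - j := by exact_mod_cast h
    rw [← Complex.exp_nat_mul, ← Complex.exp_nat_mul, ← Complex.exp_add]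
    congr 1
    linear_combination (-(Complex.I * z / 2)) * h'
  rw [aux m (p + r) (q + t) _ (by push_cast; linarith),
    aux m' (p + t) (q + r) _ (by push_cast; linarith)]
  simp only [cayleyKlein, Matrix.cons_val]
  ring

/-- The exponents of the Cayley–Klein parameters are the factorial arguments in Wigner's formula;
they add up to `2 * l`. -/
theorem wignerD_mem_entrySpan_pow (l : ℕ) (m m' : ℤ) : wignerD l m m' ∈ entrySpan ^ l := by
  have e : wignerD l m m' = ∑ s ∈ Finset.Icc (max 0 (m' - m)) (min (l + m') (l - m)),
      ((Real.sqrt ((l + m).toNat ! * (l - m).toNat ! * (l + m').toNat ! * (l - m').toNat !) *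
        ((-1) ^ (m - m' + s).toNat /
        ((l + m' - s).toNat ! * s.toNat ! * (m - m' + s).toNat ! * (l - m - s).toNat !)) : ℝ) : ℂ) •
      fun g => cayleyKlein g 0 ^ (l + m' - s).toNat * cayleyKlein g 1 ^ (l - m - s).toNat *
        cayleyKlein g 2 ^ (m - m' + s).toNat * cayleyKlein g 3 ^ s.toNat := by
    funext g
    rw [wignerD, wignerSmallD, Finset.sum_apply, Complex.ofReal_mul, Complex.ofReal_sum,
      Finset.mul_sum, Finset.mul_sum, Finset.sum_mul]
    refine Finset.sum_congr rfl fun s hs => ?_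
    -- In the range of `s` all four factorial arguments are nonnegative, so `toNat` is exact.
    simp only [Finset.mem_Icc, max_le_iff, le_min_iff] at hs
    rw [Pi.smul_apply, smul_eq_mul, cayleyKlein_monomial_eq (m := m) (m' := m') (by omega) (by omega),
      show (2 * l + m' - m - 2 * s).toNat = (l + m' - s).toNat + (l - m - s).toNat by omega,
      show (m - m' + 2 * s).toNat = (m - m' + s).toNat + s.toNat by omega]
    push_cast
    ring
  rw [e]
  refine Submodule.sum_mem _ fun s hs => Submodule.smul_mem _ _ (monomial_mem_entrySpan_pow ?_)
  simp only [Finset.mem_Icc, max_le_iff, le_min_iff] at hs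
  omega

theorem bandlimited_le (L : ℕ) : bandlimited L ≤ entrySpan ^ L := by
  rw [bandlimited, Submodule.span_le]
  rintro _ ⟨l, m, m', hl, -, -, rfl⟩
  exact pow_le_pow_right' (Submodule.one_le.2 one_mem_entrySpan) hl
    (wignerD_mem_entrySpan_pow l m m')

/-! ### Left-invariant metrics in the left-invariant frame -/

namespace RiemannianMetric

variable {m : RiemannianMetric}

theorem pair_eq (hm : m.IsBiInvariant) (A B : so3) (g : SO3) : m.pair A B g = m.pair A B 1 := by
  have h := hm.1 g 1 (leftField A 1) (leftField B 1)
  have e : ∀ A : so3, leftTranslate g 1 (leftField A 1) = leftField A (g * 1) := fun A =>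
    Subtype.ext (Matrix.mul_assoc g.1 1 A.1).symm
  rw [e, e] at h
  change m.pair A B (g * 1) = m.pair A B 1 at h
  rwa [mul_one] at h

theorem gram_eq (hm : m.IsBiInvariant) (g : SO3) : m.gram g = m.gram 1 :=
  Matrix.ext fun _ _ => pair_eq hm _ _ g

theorem vecNorm_eq (hm : m.IsBiInvariant) (g : SO3) : m.vecNorm g = m.vecNorm 1 := by
  funext v
  rw [vecNorm, vecNorm, gram_eq hm g]

theorem koszul_eq (hm : m.IsBiInvariant) (A B C : so3) (g : SO3) :
    m.koszul A B C g = m.koszul A B C 1 := by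
  have hl : ∀ (A B C : so3) (g : SO3), lieDeriv A (m.pair B C) g = 0 := by
    intro A B C g
    simp only [lieDeriv, pair_eq hm B C (g * _), deriv_const]
  simp only [koszul, hl]
  rw [pair_eq hm ⁅A, B⁆ C g, pair_eq hm ⁅A, C⁆ B g, pair_eq hm ⁅B, C⁆ A g]

theorem christoffel_eq (hm : m.IsBiInvariant) (g : SO3) : m.christoffel g = m.christoffel 1 := by
  funext i j k
  simp only [christoffel]
  rw [gram_eq hm g]
  exact Finset.sum_congr rfl fun l _ => by rw [koszul_eq hm _ _ _ g]

theorem sum_gram_eq (m : RiemannianMetric) (g : SO3) (x : Fin 3 → ℝ) :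
    ∑ i, ∑ j, m.gram g i j * x i * x j =
      m.inner g (∑ i, x i • leftField (gen i) g) (∑ i, x i • leftField (gen i) g) := by
  simp only [map_sum, LinearMap.sum_apply, map_smul, LinearMap.smul_apply, smul_eq_mul, gram, pair,
    Matrix.of_apply]
  rw [Finset.sum_comm]
  refine Finset.sum_congr rfl fun i _ => ?_
  rw [Finset.mul_sum]
  refine Finset.sum_congr rfl fun j _ => ?_
  ring

theorem sum_gram_pos (m : RiemannianMetric) {x : Fin 3 → ℝ} (hx : x ≠ 0) :
    0 < ∑ i, ∑ j, m.gram 1 i j * x i * x j := by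
  rw [sum_gram_eq]
  refine m.pos 1 _ fun h => hx ?_
  have h' : ∑ i, x i • (gen i).1 = 0 := by
    have := congrArg Subtype.val h
    simpa [leftField] using this
  funext k
  have e := fun a b => congrFun (congrFun h' a) b
  fin_cases k
  · simpa [Fin.sum_univ_three, gen] using e 2 1
  · simpa [Fin.sum_univ_three, gen] using e 0 2
  · simpa [Fin.sum_univ_three, gen] using e 1 0

theorem re_sum_gram_eq (m : RiemannianMetric) (g : SO3) (v : Fin 3 → ℂ) :
    (∑ i, ∑ j, (m.gram g i j : ℂ) * v i * (starRingEnd ℂ) (v j)).re =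
      ∑ i, ∑ j, m.gram g i j * (v i).re * (v j).re +
        ∑ i, ∑ j, m.gram g i j * (v i).im * (v j).im := by
  simp only [Complex.re_sum, ← Finset.sum_add_distrib]
  refine Finset.sum_congr rfl fun i _ => Finset.sum_congr rfl fun j _ => ?_
  simp

theorem sum_gram_nonneg (m : RiemannianMetric) (x : Fin 3 → ℝ) :
    0 ≤ ∑ i, ∑ j, m.gram 1 i j * x i * x j := by
  rcases eq_or_ne x 0 with rfl | hx
  · simp
  · exact (m.sum_gram_pos hx).le

/-- On the finite-dimensional space of components, the norm of the metric dominates the maximum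
norm: a positive continuous function is bounded below on the unit sphere. -/
theorem exists_norm_le_vecNorm (m : RiemannianMetric) :
    ∃ c : ℝ, 0 < c ∧ ∀ v, ‖v‖ ≤ c * m.vecNorm 1 v := by
  set q : (Fin 3 → ℂ) → ℝ := fun v =>
    (∑ i, ∑ j, (m.gram 1 i j : ℂ) * v i * (starRingEnd ℂ) (v j)).re with hq
  have hqc : Continuous q := by
    refine Complex.continuous_re.comp ?_
    refine continuous_finsetSum _ fun i _ => continuous_finsetSum _ fun j _ => ?_
    exact (continuous_const.mul (continuous_apply i)).mul
      (Complex.continuous_conj.comp (continuous_apply j))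
  have hpos : ∀ v, v ≠ 0 → 0 < q v := by
    intro v hv
    simp only [hq, re_sum_gram_eq]
    by_cases h : (fun i => (v i).re) = 0
    · have h' : (fun i => (v i).im) ≠ 0 := fun h' =>
        hv (funext fun i => Complex.ext (congrFun h i) (congrFun h' i))
      exact add_pos_of_nonneg_of_pos (m.sum_gram_nonneg _) (m.sum_gram_pos h')
    · exact add_pos_of_pos_of_nonneg (m.sum_gram_pos h) (m.sum_gram_nonneg _)
  have hsmul : ∀ (r : ℝ) v, q ((r : ℂ) • v) = r ^ 2 * q v := by
    intro r v
    simp only [hq, re_sum_gram_eq, mul_add, Finset.mul_sum, Pi.smul_apply, smul_eq_mul,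
      Complex.re_ofReal_mul, Complex.im_ofReal_mul]
    congr 1 <;>
    exact Finset.sum_congr rfl fun i _ => Finset.sum_congr rfl fun j _ => by ring
  obtain ⟨u, hu, hmin⟩ := (isCompact_sphere (0 : Fin 3 → ℂ) 1).exists_isMinOn
    (NormedSpace.sphere_nonempty.2 zero_le_one) hqc.continuousOn
  have hu0 : u ≠ 0 := by
    rintro rfl
    simp at hu
  have hb := hpos u hu0
  refine ⟨(Real.sqrt (q u))⁻¹, inv_pos.2 (Real.sqrt_pos.2 hb), fun v => ?_⟩
  rcases eq_or_ne v 0 with rfl | hv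
  · rw [norm_zero]
    exact mul_nonneg (inv_nonneg.2 (Real.sqrt_nonneg _)) (Real.sqrt_nonneg _)
  have hv' : 0 < ‖v‖ := norm_pos_iff.2 hv
  have h1 : q u ≤ q (((‖v‖⁻¹ : ℝ) : ℂ) • v) := by
    refine hmin ?_
    rw [mem_sphere_zero_iff_norm, norm_smul, Complex.norm_real, norm_inv, norm_norm,
      inv_mul_cancel₀ hv'.ne']
  rw [hsmul, inv_pow, ← div_eq_inv_mul, le_div_iff₀ (by positivity)] at h1
  rw [← div_eq_inv_mul, le_div_iff₀ (Real.sqrt_pos.2 hb)]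
  refine Real.le_sqrt_of_sq_le ?_
  rw [mul_pow, Real.sq_sqrt hb.le, mul_comm]
  exact h1

theorem exists_vecNorm_le (m : RiemannianMetric) :
    ∃ C : ℝ, 0 ≤ C ∧ ∀ (v : Fin 3 → ℂ) (K : ℝ), 0 ≤ K → (∀ i, ‖v i‖ ≤ K) →
      m.vecNorm 1 v ≤ C * K := by
  refine ⟨Real.sqrt (∑ i, ∑ j, |m.gram 1 i j|), Real.sqrt_nonneg _, fun v K hK hv => ?_⟩
  have e : Real.sqrt (∑ i, ∑ j, |m.gram 1 i j|) * K =
      Real.sqrt ((∑ i, ∑ j, |m.gram 1 i j|) * K ^ 2) := by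
    rw [Real.sqrt_mul (by positivity), Real.sqrt_sq hK]
  rw [vecNorm, e]
  refine Real.sqrt_le_sqrt ((Complex.re_le_norm _).trans ?_)
  rw [Finset.sum_mul]
  refine norm_sum_le_of_le _ fun i _ => ?_
  rw [Finset.sum_mul]
  refine norm_sum_le_of_le _ fun j _ => ?_
  rw [norm_mul, norm_mul, Complex.norm_conj, Complex.norm_real, Real.norm_eq_abs, pow_two,
    ← mul_assoc]
  have h1 := hv i
  have h2 := hv j
  gcongr

/-! ### Bounds for the gradient and the Hessian -/

theorem exists_gradientSupNorm_le (hm : m.IsBiInvariant) :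
    ∃ B : ℝ, 0 < B ∧ ∀ (L : ℕ) (F : SO3 → ℂ) (M : ℝ), F ∈ entrySpan ^ L → 0 ≤ M →
      (∀ g, ‖F g‖ ≤ M) → m.gradientSupNorm F ≤ ENNReal.ofReal (B * (1 + L) * M) := by
  obtain ⟨C, hC, hCv⟩ := m.exists_vecNorm_le
  obtain ⟨S, hS⟩ : ∃ S : ℝ, S = ∑ i, ∑ j, |(m.gram 1)⁻¹ i j| := ⟨_, rfl⟩
  have hS0 : 0 ≤ S := by
    rw [hS]
    positivity
  refine ⟨7 * S * C + 1, by positivity, fun L F M hF hM hFM => ?_⟩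
  have hD := fun i => norm_lieDeriv_gen_le i hF hFM
  refine iSup_le fun g => ENNReal.ofReal_le_ofReal ?_
  rw [vecNorm_eq hm g]
  refine (hCv _ (S * (7 * (1 + L) * M)) (by positivity) fun i => ?_).trans ?_
  · rw [gradient, gram_eq hm g, hS]
    calc ‖∑ j, ((m.gram 1)⁻¹ i j : ℂ) * lieDeriv (gen j) F g‖
        ≤ ∑ j, |(m.gram 1)⁻¹ i j| * (7 * (1 + L) * M) := by
          refine norm_sum_le_of_le _ fun j _ => ?_
          rw [norm_mul, Complex.norm_real, Real.norm_eq_abs]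
          exact mul_le_mul_of_nonneg_left (hD j g) (abs_nonneg _)
      _ = (∑ j, |(m.gram 1)⁻¹ i j|) * (7 * (1 + L) * M) := (Finset.sum_mul _ _ _).symm
      _ ≤ _ := by
          refine mul_le_mul_of_nonneg_right ?_ (by positivity)
          exact Finset.single_le_sum (f := fun i => ∑ j, |(m.gram 1)⁻¹ i j|)
            (fun i _ => by positivity) (Finset.mem_univ i)
  · have : 0 ≤ (1 + (L : ℝ)) * M := by positivity
    linarith

theorem exists_norm_hessian_le (hm : m.IsBiInvariant) :
    ∃ B : ℝ, 0 < B ∧ ∀ (L : ℕ) (F : SO3 → ℂ) (M : ℝ), F ∈ entrySpan ^ L → 0 ≤ M →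
      (∀ g, ‖F g‖ ≤ M) → ∀ g i j, ‖m.hessian F g i j‖ ≤ B * (1 + L) ^ 2 * M := by
  obtain ⟨T, hT⟩ : ∃ T : ℝ, T = ∑ i, ∑ j, ∑ k, |m.christoffel 1 i j k| := ⟨_, rfl⟩
  have hT0 : 0 ≤ T := by
    rw [hT]
    positivity
  refine ⟨49 + 7 * T, by positivity, fun L F M hF hM hFM g i j => ?_⟩
  have hD := fun i => norm_lieDeriv_gen_le i hF hFM
  have h1 : ‖lieDeriv (gen i) (lieDeriv (gen j) F) g‖ ≤ 7 * (1 + L) * (7 * (1 + L) * M) :=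
    norm_lieDeriv_gen_le i (lieDeriv_mem_entrySpan_pow (gen j) hF) (hD j) g
  have h2 : ‖∑ k, (m.christoffel g i j k : ℂ) * lieDeriv (gen k) F g‖
      ≤ T * (7 * (1 + L) * M) := by
    rw [christoffel_eq hm g]
    calc ‖∑ k, (m.christoffel 1 i j k : ℂ) * lieDeriv (gen k) F g‖
        ≤ ∑ k, |m.christoffel 1 i j k| * (7 * (1 + L) * M) := by
          refine norm_sum_le_of_le _ fun k _ => ?_
          rw [norm_mul, Complex.norm_real, Real.norm_eq_abs]
          exact mul_le_mul_of_nonneg_left (hD k g) (abs_nonneg _)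
      _ = (∑ k, |m.christoffel 1 i j k|) * (7 * (1 + L) * M) := (Finset.sum_mul _ _ _).symm
      _ ≤ _ := by
          refine mul_le_mul_of_nonneg_right ?_ (by positivity)
          rw [hT]
          refine (Finset.single_le_sum (f := fun j => ∑ k, |m.christoffel 1 i j k|)
            (fun j _ => by positivity) (Finset.mem_univ j)).trans ?_
          exact Finset.single_le_sum (f := fun i => ∑ j, ∑ k, |m.christoffel 1 i j k|)
            (fun i _ => by positivity) (Finset.mem_univ i)
  have h3 : T * (7 * (1 + L) * M) ≤ T * (7 * (1 + L) ^ 2 * M) := by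
    gcongr
    exact le_self_pow₀ (by linarith [(Nat.cast_nonneg L : (0 : ℝ) ≤ L)]) two_ne_zero
  refine (norm_sub_le _ _).trans ?_
  linarith

theorem exists_hessianSupNorm_le (hm : m.IsBiInvariant) :
    ∃ B : ℝ, 0 < B ∧ ∀ (L : ℕ) (F : SO3 → ℂ) (M : ℝ), F ∈ entrySpan ^ L → 0 ≤ M →
      (∀ g, ‖F g‖ ≤ M) → m.hessianSupNorm F ≤ ENNReal.ofReal (B * (1 + L) ^ 2 * M) := by
  obtain ⟨c, hc, hcv⟩ := m.exists_norm_le_vecNorm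
  obtain ⟨B, hB, hH⟩ := exists_norm_hessian_le hm
  refine ⟨9 * c ^ 2 * B, by positivity, fun L F M hF hM hFM => ?_⟩
  refine iSup_le fun g => iSup_le fun v => iSup_le fun w => iSup_le fun hv => iSup_le fun hw => ?_
  rw [vecNorm_eq hm g] at hv hw
  have hb : ∀ v : Fin 3 → ℂ, m.vecNorm 1 v ≤ 1 → ∀ i, ‖v i‖ ≤ c := fun v hv i =>
    ((norm_le_pi_norm v i).trans (hcv v)).trans (mul_le_of_le_one_right hc.le hv)
  rw [← ofReal_norm]
  refine ENNReal.ofReal_le_ofReal ?_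
  calc ‖∑ i, ∑ j, v i * w j * m.hessian F g i j‖
      ≤ ∑ _i : Fin 3, ∑ _j : Fin 3, c * c * (B * (1 + L) ^ 2 * M) := by
        refine norm_sum_le_of_le _ fun i _ => norm_sum_le_of_le _ fun j _ => ?_
        rw [norm_mul, norm_mul]
        have h1 := hb v hv i
        have h2 := hb w hw j
        have h3 := hH L F M hF hM hFM g i j
        gcongr
    _ = _ := by
        simp only [Finset.sum_const, Finset.card_univ, Fintype.card_fin, nsmul_eq_mul]
        push_cast
        ring

end RiemannianMetric

theorem supNorm_lt_top {F : SO3 → ℂ} {M : ℝ} (hM : ∀ g, ‖F g‖ ≤ M) : supNorm F < ⊤ := by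
  refine (iSup_le fun g => ?_ : supNorm F ≤ ENNReal.ofReal M).trans_lt ENNReal.ofReal_lt_top
  rw [← ofReal_norm]
  exact ENNReal.ofReal_le_ofReal (hM g)

theorem norm_le_toReal_supNorm {F : SO3 → ℂ} (hF : supNorm F < ⊤) (g : SO3) :
    ‖F g‖ ≤ (supNorm F).toReal := by
  rw [← toReal_enorm]
  exact ENNReal.toReal_mono hF.ne (le_iSup (fun g => ‖F g‖ₑ) g)

end SO3Bernstein

end

theorem mainTheorem2 (m : SO3Bernstein.RiemannianMetric) (hm : m.IsBiInvariant) :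
    ∃ B₁ B₂ : ℝ, 0 < B₁ ∧ 0 < B₂ ∧
      ∀ (L : ℕ) (F : SO3Bernstein.SO3 → ℂ), F ∈ SO3Bernstein.bandlimited L →
        SO3Bernstein.IsSmooth F ∧ SO3Bernstein.supNorm F < ⊤ ∧
        m.gradientSupNorm F ≤ ENNReal.ofReal (B₁ * (1 + L)) * SO3Bernstein.supNorm F ∧
        m.hessianSupNorm F ≤ ENNReal.ofReal (B₂ * (1 + L) ^ 2) * SO3Bernstein.supNorm F := by
  obtain ⟨B₁, hB₁, h₁⟩ := SO3Bernstein.RiemannianMetric.exists_gradientSupNorm_le hm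
  obtain ⟨B₂, hB₂, h₂⟩ := SO3Bernstein.RiemannianMetric.exists_hessianSupNorm_le hm
  refine ⟨B₁, B₂, hB₁, hB₂, fun L F hF => ?_⟩
  have hF' := SO3Bernstein.bandlimited_le L hF
  obtain ⟨M, hM⟩ := SO3Bernstein.exists_norm_le_of_mem_entrySpan_pow hF'
  have htop := SO3Bernstein.supNorm_lt_top hM
  have hFM := SO3Bernstein.norm_le_toReal_supNorm htop
  refine ⟨SO3Bernstein.isSmooth_of_mem_entrySpan_pow hF', htop, ?_, ?_⟩
  · refine (h₁ L F _ hF' ENNReal.toReal_nonneg hFM).trans_eq ?_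
    rw [ENNReal.ofReal_mul (by positivity), ENNReal.ofReal_toReal htop.ne]
  · refine (h₂ L F _ hF' ENNReal.toReal_nonneg hFM).trans_eq ?_
    rw [ENNReal.ofReal_mul (by positivity), ENNReal.ofReal_toReal htop.ne]
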